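/- A vertex operator algebra (VOA) of central charge $C\in\mathbb{C}$ is a complex vector space $V=\bigoplus_{k\ge 0}V_k$ with $V_0=\mathbb{C}\mathbf{1}$, $\mathbf 1\neq 0$, with mutually local vertex operators $Y(a,z)=\sum_{n\in\mathbb{Z}}a_nz^{-n-1}$ depending linearly on $a\in V$ (where $a_n\in\mathrm{End}(V)$ and, for each $b\in V$, $a_nb=0$ for $n$ large) such that $Y(\mathbf 1,z)=\mathrm{id}$, $a_{-1}\mathbf 1=a$, $a_n\mathbf 1=0$ for $n\ge 0$, and with a conformal vector $\omega\in V_2$, $Y(\omega,z)=\sum_n L_nz^{-n-2}$, whose modes satisfy the Virasoro algebra of central charge $C$, with $L_0=k$ on $V_k$ and $Y(L_{-1}a,z)=\partial_zY(a,z)=[L_{-1},Y(a,z)]$. Let $V$ be such a VOA with a Li–Zamolodchikov metric, that is, a symmetric nondegenerate bilinear form $\langle\,,\rangle$ on $V$ with $\langle\mathbf 1,\mathbf 1\rangle=1$ and $$\langle Y(e^{zL_1}(-z^{-2})^{L_0}c,z^{-1})a,b\rangle=\langle a,Y(c,z)b\rangle\qquad(a,b,c\in V).$$ Suppose that $d_1=\dim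 V_1$ is finite and $d_1>0$, let $\{u_\alpha\}$ be a basis of $V_1$ and $\{u^\alpha\}$ the dual basis with $\langle u^\alpha,u_\beta\rangle=\delta^\alpha_\beta$, and put $$\lambda^{(4)}=\sum_{\alpha=1}^{d_1}u^\alpha_{-3}u_\alpha\in V_4 .$$ If $\lambda^{(4)}$ is a Virasoro descendant of the vacuum, i.e. a linear combination of vectors $L_{-n_1}\cdots L_{-n_r}\mathbf 1$ with $n_i\ge1$ and $n_1+\dots+n_r=4$, and if $C\neq 0,-\tfrac{22}{5}$, then $C\neq 10$ and $$d_1=\frac{C(5C+22)}{10-C}.$$ -/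

import Mathlib

open Module

/-- The mode `a_n` of the vertex operator `Y(a,z) = ∑_{n ∈ ℤ} a_n z^{-n-1}`. -/
noncomputable def vmode {V : Type*} [AddCommGroup V] [Module ℂ V]
    (Y : V →ₗ[ℂ] VertexOperator ℂ V) (a : V) (n : ℤ) : Module.End ℂ V :=
  VertexOperator.ncoeff (Y a) n

/-- Mutual locality of `Y(a,z)` and `Y(b,w)`: for some `N`, the coefficient of each
`z^{-m-1} w^{-n-1}` in `(z - w)^N [Y(a,z), Y(b,w)]` vanishes. -/
def MutuallyLocal {V : Type*} [AddCommGroup V] [Module ℂ V]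
    (Y : V →ₗ[ℂ] VertexOperator ℂ V) (a b : V) : Prop :=
  ∃ N : ℕ, ∀ m n : ℤ,
    ∑ i ∈ Finset.range (N + 1), ((-1 : ℂ) ^ i * (N.choose i : ℂ)) •
      (vmode Y a (m + N - i) * vmode Y b (n + i) - vmode Y b (n + i) * vmode Y a (m + N - i)) = 0

/-- A vertex operator algebra structure on the complex vector space `V`, with grading
`V = ⨁_{k ≥ 0} V_k` and `V_0 = ℂ 𝟏`. That `Y a` is a `VertexOperator` says that `a_n b = 0` for
`n` large. The Virasoro operators are `L_n = ω_{n+1}`, that is `Y(ω,z) = ∑ L_n z^{-n-2}`. -/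
structure VertexOperatorAlgebra (V : Type*) [AddCommGroup V] [Module ℂ V] where
  /-- the homogeneous subspaces `V_k` -/
  grade : ℕ → Submodule ℂ V
  isInternal_grade : DirectSum.IsInternal grade
  /-- the state-field correspondence -/
  Y : V →ₗ[ℂ] VertexOperator ℂ V
  /-- the vacuum vector `𝟏` -/
  vac : V
  vac_ne_zero : vac ≠ 0
  grade_zero : grade 0 = Submodule.span ℂ {vac}
  vacuum : ∀ (n : ℤ) (a : V), vmode Y vac n a = if n = -1 then a else 0
  creation : ∀ a : V, vmode Y a (-1) vac = a
  creation_regular : ∀ (a : V) (n : ℤ), 0 ≤ n → vmode Y a n vac = 0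
  locality : ∀ a b : V, MutuallyLocal Y a b
  /-- the conformal vector `ω` -/
  conf : V
  conf_mem : conf ∈ grade 2
  /-- the central charge `C` -/
  centralCharge : ℂ
  virasoro : ∀ m n : ℤ,
    vmode Y conf (m + 1) * vmode Y conf (n + 1) - vmode Y conf (n + 1) * vmode Y conf (m + 1) =
      ((m : ℂ) - n) • vmode Y conf (m + n + 1) +
        (if m + n = 0 then centralCharge / 12 * ((m : ℂ) ^ 3 - m) else 0) • (1 : Module.End ℂ V)
  /-- `L_0 v = k v` for `v ∈ V_k` -/
  weight : ∀ (k : ℕ), ∀ v ∈ grade k, vmode Y conf 1 v = (k : ℂ) • v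
  /-- `L_{-1}` generates translations: `[L_{-1}, Y(a,z)] = ∂_z Y(a,z)` -/
  translation : ∀ (a : V) (n : ℤ),
    vmode Y conf 0 * vmode Y a n - vmode Y a n * vmode Y conf 0 = -(n : ℂ) • vmode Y a (n - 1)
  /-- `Y(L_{-1} a, z) = ∂_z Y(a,z)` -/
  derivative : ∀ (a : V) (n : ℤ),
    vmode Y (vmode Y conf 0 a) n = -(n : ℂ) • vmode Y a (n - 1)

namespace VertexOperatorAlgebra

variable {V : Type*} [AddCommGroup V] [Module ℂ V]

/-- The mode `a_n` of the state `a`. -/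
noncomputable def mode (A : VertexOperatorAlgebra V) (a : V) (n : ℤ) : Module.End ℂ V :=
  vmode A.Y a n

/-- The Virasoro operator `L_n = ω_{n+1}`. -/
noncomputable def L (A : VertexOperatorAlgebra V) (n : ℤ) : Module.End ℂ V :=
  A.mode A.conf (n + 1)

/-- A Li-Zamolodchikov metric: a symmetric nondegenerate bilinear form with `⟨𝟏,𝟏⟩ = 1` and
`⟨Y(e^{z L_1} (-z^{-2})^{L_0} c, z^{-1}) a, b⟩ = ⟨a, Y(c,z) b⟩`. The last identity is stated for
`c ∈ V_k` by comparing the coefficients of `z^{-n-1}`; since `L_1` lowers the weight by one,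
`L_1^j c = 0` for `j > k`. -/
structure IsLiZMetric (A : VertexOperatorAlgebra V) (B : LinearMap.BilinForm ℂ V) : Prop where
  symm : ∀ a b : V, B a b = B b a
  nondegenerate : B.Nondegenerate
  normalized : B A.vac A.vac = 1
  invariant : ∀ (k : ℕ), ∀ c ∈ A.grade k, ∀ (n : ℤ) (a b : V),
    (-1 : ℂ) ^ k * ∑ j ∈ Finset.range (k + 1),
        ((j.factorial : ℂ))⁻¹ * B (A.mode ((A.L 1 ^ j) c) (2 * k - j - n - 2) a) b =
      B a (A.mode c n b)

/-- The space `V_n(C,0)` of Virasoro descendants of the vacuum of weight `n`, spanned by the vectors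
`L_{-n_1} ⋯ L_{-n_r} 𝟏` with `n_i ≥ 1` and `n_1 + ⋯ + n_r = n`. -/
def vacuumDescendants (A : VertexOperatorAlgebra V) (n : ℕ) : Submodule ℂ V :=
  Submodule.span ℂ {v | ∃ l : List ℕ, (∀ k ∈ l, 1 ≤ k) ∧ l.sum = n ∧
    v = l.foldr (fun k w => A.L (-(k : ℤ)) w) A.vac}

/-- The quadratic Casimir vector `λ^{(n)} = ∑_α u^α_{1-n} u_α` of a pair of families
`u_α`, `u^α`. -/
noncomputable def casimir (A : VertexOperatorAlgebra V) {ι : Type*} [Fintype ι]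
    (uLow uUp : ι → V) (n : ℕ) : V :=
  ∑ α, A.mode (uUp α) (1 - n) (uLow α)

end VertexOperatorAlgebra

/-! In weight 4 the vacuum descendants are spanned by L_{-4}𝟏 and L_{-2}²𝟏, so λ = p L_{-4}𝟏 + q
L_{-2}²𝟏. Applying L_4, and L_2 twice, expresses d_1 in p, q in two ways, whence p = (C+2)q/4
because C ≠ 0. For a dual pair b, c in V_1, pairing λ with b_{-3}c and L_2 λ = 3 ∑ u^α_{-1}u_α with
b_{-1}c gives two more equations. Both contain the same trace X = ∑ ⟨u_α, (u^α_0 b)_0 c⟩, of Killing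
form type; eliminating it leaves q(C - 10) = 12. Hence C ≠ 10, and the L_4 equation yields d_1.

The pairings rest on `current_adjoint` and on `mode_commutator`, which must be derived from
locality. The defect of the commutator formula kills the vacuum (by translation) and becomes local
with every field, so on v = v_{-1}𝟏 it vanishes for large m; locality of a and b then brings this
down to all m ≥ 0. -/

/-! ### Difference operators on functions of mode indices. -/

/-- The difference of the translations of functions along two self-maps of the index type. -/
noncomputable def shiftSub {I : Type*} (W : Type*) [AddCommGroup W] [Module ℂ W] (s t : I → I) :
    Module.End ℂ (I → W) :=
  LinearMap.funLeft ℂ W s - LinearMap.funLeft ℂ W t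

section Shift

variable {I W : Type*} [AddCommGroup W] [Module ℂ W]

theorem shiftSub_apply (s t : I → I) (F : I → W) (p : I) :
    shiftSub W s t F p = F (s p) - F (t p) := rfl

theorem funLeft_pow_apply (s : I → I) (k : ℕ) (F : I → W) (p : I) :
    ((LinearMap.funLeft ℂ W s : Module.End ℂ (I → W)) ^ k) F p = F (s^[k] p) := by
  induction k generalizing p with
  | zero => rfl
  | succ k ih =>
    rw [pow_succ', Module.End.mul_apply, LinearMap.funLeft_apply, ih, Function.iterate_succ_apply]

/-- On coefficients, multiplication by z - w is a difference of two index shifts, so locality says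
that a power of `shiftSub` vanishes; this is the binomial expansion of that power. -/
theorem shiftSub_pow_apply {s t : I → I} (h : ∀ p, s (t p) = t (s p)) (N : ℕ) (F : I → W) (p : I) :
    (shiftSub W s t ^ N) F p =
      ∑ i ∈ Finset.range (N + 1), ((-1 : ℂ) ^ i * (N.choose i : ℂ)) • F (s^[N - i] (t^[i] p)) := by
  have hc : Commute ((-1 : ℂ) • (LinearMap.funLeft ℂ W t : Module.End ℂ (I → W)))
      (LinearMap.funLeft ℂ W s) := by
    refine Commute.smul_left (LinearMap.ext fun F => funext fun p => ?_) _
    simp [LinearMap.funLeft_apply, h]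
  rw [shiftSub, sub_eq_neg_add, ← neg_one_smul ℂ, hc.add_pow, LinearMap.sum_apply, Finset.sum_apply]
  refine Finset.sum_congr rfl fun i _ => ?_
  rw [← nsmul_eq_mul', smul_pow, smul_mul_assoc, LinearMap.smul_apply, Pi.smul_apply,
    LinearMap.smul_apply, Pi.smul_apply, Module.End.mul_apply, funLeft_pow_apply,
    funLeft_pow_apply, mul_smul, ← Nat.cast_smul_eq_nsmul ℂ, smul_comm]

theorem pow_apply_eq_zero_of_le {P : Module.End ℂ W} {x : W} {N M : ℕ} (h : (P ^ N) x = 0)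
    (hNM : N ≤ M) : (P ^ M) x = 0 := by
  rw [← Nat.sub_add_cancel hNM, pow_add, Module.End.mul_apply, h, map_zero]

end Shift

/-- Raise the first of three mode indices. -/
def raiseFst (p : ℕ × ℤ × ℤ) : ℕ × ℤ × ℤ := (p.1 + 1, p.2.1, p.2.2)
/-- Raise the second of three mode indices. -/
def raiseSnd (p : ℕ × ℤ × ℤ) : ℕ × ℤ × ℤ := (p.1, p.2.1 + 1, p.2.2)
/-- Raise the third of three mode indices. -/
def raiseThd (p : ℕ × ℤ × ℤ) : ℕ × ℤ × ℤ := (p.1, p.2.1, p.2.2 + 1)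

theorem raiseFst_iterate (k : ℕ) (p : ℕ × ℤ × ℤ) :
    raiseFst^[k] p = (p.1 + k, p.2.1, p.2.2) := by
  induction k with
  | zero => simp
  | succ k ih => rw [Function.iterate_succ_apply', ih]; simp [raiseFst, add_assoc]

theorem raiseSnd_iterate (k : ℕ) (p : ℕ × ℤ × ℤ) :
    raiseSnd^[k] p = (p.1, p.2.1 + k, p.2.2) := by
  induction k with
  | zero => simp
  | succ k ih => rw [Function.iterate_succ_apply', ih]; simp [raiseSnd, add_assoc]

theorem raiseThd_iterate (k : ℕ) (p : ℕ × ℤ × ℤ) :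
    raiseThd^[k] p = (p.1, p.2.1, p.2.2 + k) := by
  induction k with
  | zero => simp
  | succ k ih => rw [Function.iterate_succ_apply', ih]; simp [raiseThd, add_assoc]

section Lowest

variable {W : Type*} [AddCommGroup W] [Module ℂ W]

/-- From third index -1, raising that index lands where the function vanishes, so only the pure
power of `s` survives. -/
theorem shiftSub_pow_lowest {s : ℕ × ℤ × ℤ → ℕ × ℤ × ℤ} (hs : ∀ p, (s p).2.2 = p.2.2)
    (N : ℕ) (F : ℕ × ℤ × ℤ → W) (hF : ∀ p, 0 ≤ p.2.2 → F p = 0) :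
    (∀ p, 0 ≤ p.2.2 → (shiftSub W s raiseThd ^ N) F p = 0) ∧
      ∀ p, p.2.2 = -1 → (shiftSub W s raiseThd ^ N) F p = F (s^[N] p) := by
  induction N with
  | zero => exact ⟨by simpa using hF, by simp⟩
  | succ N ih =>
    constructor
    · intro p hp
      rw [pow_succ', Module.End.mul_apply, shiftSub_apply, ih.1 _ (by rw [hs]; exact hp),
        ih.1 _ (by simp [raiseThd]; lia), sub_zero]
    · intro p hp
      rw [pow_succ', Module.End.mul_apply, shiftSub_apply, ih.2 _ (by rw [hs]; exact hp),
        ih.1 _ (by simp [raiseThd]; lia), sub_zero, Function.iterate_succ_apply]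

/-- The lowest coefficient of the product of powers is F with the first two indices raised by M. The
second can be shifted back in ℤ; the first lies in ℕ, so only values at least M are reached. -/
theorem eq_zero_of_shiftSub_pow {F : ℕ × ℤ × ℤ → W} (hF : ∀ p, 0 ≤ p.2.2 → F p = 0) {M : ℕ}
    (h : (shiftSub W raiseFst raiseThd ^ M) ((shiftSub W raiseSnd raiseThd ^ M) F) = 0)
    (m : ℕ) (n : ℤ) : F (m + M, n, -1) = 0 := by
  have h1 := shiftSub_pow_lowest (s := raiseSnd) (fun _ => rfl) M F hF
  have h2 := (shiftSub_pow_lowest (s := raiseFst) (fun _ => rfl) M _ h1.1).2 (m, n - M, -1) rfl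
  rw [h, h1.2 _ (by rw [raiseFst_iterate]), raiseFst_iterate, raiseSnd_iterate] at h2
  simpa using h2.symm

/-- A function killed by a power of the difference of the first two shifts, and vanishing for large
first index, vanishes. -/
theorem eq_zero_of_shiftSub_pow_of_large {F : ℕ × ℤ × ℤ → W} {N M : ℕ}
    (h : (shiftSub W raiseFst raiseSnd ^ N) F = 0) {k : ℤ}
    (hF : ∀ (m : ℕ) (n : ℤ), F (m + M, n, k) = 0) (m : ℕ) (n : ℤ) : F (m, n, k) = 0 := by
  induction M generalizing m n with
  | zero => exact hF m n
  | succ M ih =>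
    refine ih (fun m n => ?_) m n
    induction m using Nat.strong_induction_on generalizing n with
    | _ m _ =>
    rcases m with _ | m
    -- With first index M, every term of the recursion except `i = N` has a larger first index,
    -- hence is already zero.
    · have h1 := congrFun h (0 + M, n - N, k)
      rw [shiftSub_pow_apply (s := raiseFst) (t := raiseSnd) (fun _ => rfl),
        Finset.sum_eq_single_of_mem N (by simp)] at h1
      · rw [raiseSnd_iterate] at h1
        simpa using h1
      · intro i hi hiN
        have hi' : i < N := by have := Finset.mem_range.1 hi; lia
        rw [raiseSnd_iterate, raiseFst_iterate]
        have := hF (N - i - 1) (n - N + i)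
        rw [show N - i - 1 + (M + 1) = 0 + M + (N - i) by lia] at this
        simp only [this, smul_zero]
    · have := hF m n
      rwa [show m + (M + 1) = m + 1 + M by lia] at this

end Lowest

/-! ### The commutator formula from locality. -/

namespace VertexOperatorAlgebra

variable {V : Type*} [AddCommGroup V] [Module ℂ V]

theorem exists_mode_eq_zero (A : VertexOperatorAlgebra V) (a b : V) :
    ∃ K : ℕ, ∀ n : ℤ, K ≤ n → A.mode a n b = 0 := by
  refine ⟨(-((HahnModule.of ℂ).symm (A.Y a b)).order).toNat, fun n hn => ?_⟩
  refine VertexOperator.ncoeff_eq_zero_of_lt_order (A.Y a) n b ?_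
  have := Int.self_le_toNat (-((HahnModule.of ℂ).symm (A.Y a b)).order)
  lia

theorem mode_vac (A : VertexOperatorAlgebra V) (a : V) {n : ℤ} (hn : 0 ≤ n) :
    A.mode a n A.vac = 0 := A.creation_regular a n hn

theorem mode_neg_one_vac (A : VertexOperatorAlgebra V) (a : V) : A.mode a (-1) A.vac = a :=
  A.creation a

theorem mode_zero_left (A : VertexOperatorAlgebra V) (n : ℤ) : A.mode 0 n = 0 := by
  simp [mode, vmode]

theorem mode_smul_left (A : VertexOperatorAlgebra V) (c : ℂ) (a : V) (n : ℤ) :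
    A.mode (c • a) n = c • A.mode a n := by
  simp [mode, vmode]

theorem vac_mode (A : VertexOperatorAlgebra V) (n : ℤ) (a : V) :
    A.mode A.vac n a = if n = -1 then a else 0 := A.vacuum n a

theorem translation_apply (A : VertexOperatorAlgebra V) (a v : V) (n : ℤ) :
    A.mode A.conf 0 (A.mode a n v) =
      A.mode a n (A.mode A.conf 0 v) - (n : ℂ) • A.mode a (n - 1) v := by
  have := LinearMap.congr_fun (A.translation a n) v
  simp only [LinearMap.sub_apply, Module.End.mul_apply, LinearMap.smul_apply, neg_smul,
    LinearMap.neg_apply] at this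
  simp only [mode]
  rw [sub_eq_iff_eq_add] at this
  rw [this]; abel

theorem derivative_apply (A : VertexOperatorAlgebra V) (a : V) (n : ℤ) :
    A.mode (A.mode A.conf 0 a) n = -(n : ℂ) • A.mode a (n - 1) := A.derivative a n

theorem local_apply (A : VertexOperatorAlgebra V) (a b : V) : ∃ N : ℕ, ∀ (m n : ℤ) (v : V),
    ∑ i ∈ Finset.range (N + 1), ((-1 : ℂ) ^ i * (N.choose i : ℂ)) •
      (A.mode a (m + N - i) (A.mode b (n + i) v) - A.mode b (n + i) (A.mode a (m + N - i) v)) =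
        0 := by
  obtain ⟨N, hN⟩ := A.locality a b
  refine ⟨N, fun m n v => ?_⟩
  have := LinearMap.congr_fun (hN m n) v
  simpa [LinearMap.sum_apply, mode] using this

/-- The difference of the two sides of the commutator formula. -/
noncomputable def bracketDefect (A : VertexOperatorAlgebra V) (a b : V) (K m : ℕ) (n : ℤ) :
    Module.End ℂ V :=
  A.mode a m * A.mode b n - A.mode b n * A.mode a m -
    ∑ j ∈ Finset.range K, (m.choose j : ℂ) • A.mode (A.mode a j b) (m + n - j)

theorem bracketDefect_apply (A : VertexOperatorAlgebra V) (a b : V) (K m : ℕ) (n : ℤ) (v : V) :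
    A.bracketDefect a b K m n v = A.mode a m (A.mode b n v) - A.mode b n (A.mode a m v) -
      ∑ j ∈ Finset.range K, (m.choose j : ℂ) • A.mode (A.mode a j b) (m + n - j) v := by
  simp [bracketDefect, LinearMap.sum_apply]

/-- Induction on k: L_{-1} kills 𝟏 and sends b_{-1-k}𝟏 to (k+1) b_{-2-k}𝟏. For k = 0 only j = m
survives: creation kills j < m and the binomial kills j > m. -/
theorem mode_mode_vac (A : VertexOperatorAlgebra V) {a b : V} {K : ℕ}
    (hK : ∀ n : ℤ, K ≤ n → A.mode a n b = 0) (k m : ℕ) :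
    A.mode a m (A.mode b (-1 - k) A.vac) =
      ∑ j ∈ Finset.range K, (m.choose j : ℂ) • A.mode (A.mode a j b) (m + (-1 - k) - j) A.vac := by
  have hT : A.mode A.conf 0 A.vac = 0 := A.mode_vac _ le_rfl
  induction k generalizing m with
  | zero =>
    simp only [Nat.cast_zero, sub_zero, mode_neg_one_vac]
    rcases lt_or_ge m K with hm | hm
    · rw [Finset.sum_eq_single_of_mem m (Finset.mem_range.2 hm)]
      · simp [show (m : ℤ) + -1 - m = -1 by ring, mode_neg_one_vac]
      · intro j _ hj
        rcases lt_or_gt_of_ne hj with h | h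
        · rw [A.mode_vac _ (by lia), smul_zero]
        · rw [Nat.choose_eq_zero_of_lt h, Nat.cast_zero, zero_smul]
    · rw [hK m (by exact_mod_cast hm), eq_comm]
      refine Finset.sum_eq_zero fun j hj => ?_
      rw [A.mode_vac _ (by have := Finset.mem_range.1 hj; lia), smul_zero]
  | succ k ih =>
    have hb := A.translation_apply b A.vac (-1 - k)
    have ha := A.translation_apply a (A.mode b (-1 - k) A.vac) m
    rw [hT, map_zero, zero_sub] at hb
    rw [hb, map_neg, map_smul, ih, map_sum] at ha
    have hk : ((k : ℂ) + 1) ≠ 0 := Nat.cast_add_one_ne_zero k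
    have hidx : (-1 - ((k + 1 : ℕ) : ℤ)) = -1 - (k : ℤ) - 1 := by push_cast; ring
    refine smul_right_injective V hk ?_
    simp only
    have ha' : ((k : ℂ) + 1) • A.mode a m (A.mode b (-1 - ((k + 1 : ℕ) : ℤ)) A.vac) =
        (m : ℂ) • A.mode a (m - 1) (A.mode b (-1 - k) A.vac) +
        ∑ j ∈ Finset.range K, A.mode A.conf 0
          ((m.choose j : ℂ) • A.mode (A.mode a j b) (m + (-1 - k) - j) A.vac) := by
      rw [ha, hidx]
      push_cast
      module
    have hm : (m : ℂ) • A.mode a (m - 1) (A.mode b (-1 - k) A.vac) =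
        ∑ j ∈ Finset.range K, ((m : ℂ) * ((m - 1).choose j : ℂ)) •
          A.mode (A.mode a j b) (m + (-1 - k) - j - 1) A.vac := by
      rcases m with _ | m
      · simp
      · have := ih m
        rw [show (((m + 1 : ℕ) : ℤ) - 1) = m by push_cast; ring, this, Finset.smul_sum]
        refine Finset.sum_congr rfl fun j _ => ?_
        rw [mul_smul, Nat.add_sub_cancel]
        congr 4
        push_cast; ring
    rw [ha', hm, Finset.smul_sum, ← Finset.sum_add_distrib]
    refine Finset.sum_congr rfl fun j _ => ?_
    rw [map_smul, translation_apply, hT, map_zero, zero_sub, hidx,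
      show (m : ℤ) + (-1 - k - 1) - j = m + (-1 - k) - j - 1 by ring, smul_neg, smul_smul, ← neg_smul,
      ← add_smul, smul_smul]
    congr 1
    have hch : (m : ℂ) * ((m - 1).choose j : ℂ) = ((m : ℂ) - j) * (m.choose j : ℂ) := by
      rcases m with _ | m
      · rcases j with _ | j <;> simp
      · rcases le_or_gt j (m + 1) with h | h
        · have := Nat.choose_mul_succ_eq m j
          rw [← Nat.cast_sub h]
          rw [Nat.add_sub_cancel, mul_comm (((m + 1 - j : ℕ)) : ℂ), mul_comm (((m + 1 : ℕ)) : ℂ)]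
          exact_mod_cast this
        · rw [Nat.choose_eq_zero_of_lt h, Nat.choose_eq_zero_of_lt (by lia)]; simp
    rw [hch]
    push_cast
    ring

theorem bracketDefect_vac (A : VertexOperatorAlgebra V) {a b : V} {K : ℕ}
    (hK : ∀ n : ℤ, K ≤ n → A.mode a n b = 0) (m : ℕ) (n : ℤ) :
    A.bracketDefect a b K m n A.vac = 0 := by
  rw [bracketDefect_apply, A.mode_vac a (by lia), map_zero, sub_zero, sub_eq_zero]
  rcases lt_or_ge n 0 with hn | hn
  · obtain ⟨k, rfl⟩ : ∃ k : ℕ, n = -1 - k := ⟨(-1 - n).toNat, by lia⟩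
    exact A.mode_mode_vac hK k m
  · rw [A.mode_vac b hn, map_zero, eq_comm]
    refine Finset.sum_eq_zero fun j _ => ?_
    rcases lt_or_ge m j with h | h
    · rw [Nat.choose_eq_zero_of_lt h, Nat.cast_zero, zero_smul]
    · rw [A.mode_vac _ (by lia), smul_zero]

theorem shiftSub_pow_bracket (A : VertexOperatorAlgebra V) (b v : V) : ∃ N : ℕ,
    ∀ (X : ℕ → Module.End ℂ V) (w : V), (shiftSub V raiseSnd raiseThd ^ N)
      (fun p => X p.1 (A.mode b p.2.1 (A.mode v p.2.2 w) - A.mode v p.2.2 (A.mode b p.2.1 w))) =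
        0 := by
  obtain ⟨N, hN⟩ := A.local_apply b v
  refine ⟨N, fun X w => funext fun p => ?_⟩
  rw [shiftSub_pow_apply (s := raiseSnd) (t := raiseThd) (fun _ => rfl), Pi.zero_apply,
    ← map_zero (X p.1), ← hN p.2.1 p.2.2 w, map_sum]
  refine Finset.sum_congr rfl fun i hi => ?_
  have := Finset.mem_range.1 hi
  rw [raiseThd_iterate, raiseSnd_iterate, map_smul]
  simp only
  rw [show p.2.1 + ((N - i : ℕ) : ℤ) = p.2.1 + N - i by lia]

theorem shiftSub_pow_bracket_left (A : VertexOperatorAlgebra V) (a v : V) : ∃ N : ℕ,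
    ∀ (X : ℤ → Module.End ℂ V) (w : ℤ → V), (shiftSub V raiseFst raiseThd ^ N)
      (fun p => X p.2.1 (A.mode a p.1 (A.mode v p.2.2 (w p.2.1)) -
        A.mode v p.2.2 (A.mode a p.1 (w p.2.1)))) = 0 := by
  obtain ⟨N, hN⟩ := A.local_apply a v
  refine ⟨N, fun X w => funext fun p => ?_⟩
  rw [shiftSub_pow_apply (s := raiseFst) (t := raiseThd) (fun _ => rfl), Pi.zero_apply,
    ← map_zero (X p.2.1), ← hN p.1 p.2.2 (w p.2.1), map_sum]
  refine Finset.sum_congr rfl fun i hi => ?_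
  have := Finset.mem_range.1 hi
  rw [raiseThd_iterate, raiseFst_iterate, map_smul]
  simp only
  rw [show ((p.1 + (N - i) : ℕ) : ℤ) = p.1 + N - i by lia]

theorem shiftSub_pow_residue (A : VertexOperatorAlgebra V) (c v w : V) (j : ℕ) : ∃ N : ℕ,
    (shiftSub V raiseSnd raiseThd ^ N)
      (fun p => (p.1.choose j : ℂ) • (A.mode c (p.1 + p.2.1 - j) (A.mode v p.2.2 w) -
        A.mode v p.2.2 (A.mode c (p.1 + p.2.1 - j) w))) = 0 := by
  obtain ⟨N, hN⟩ := A.local_apply c v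
  refine ⟨N, funext fun p => ?_⟩
  rw [shiftSub_pow_apply (s := raiseSnd) (t := raiseThd) (fun _ => rfl), Pi.zero_apply,
    ← smul_zero (p.1.choose j : ℂ), ← hN (p.1 + p.2.1 - j) p.2.2 w, Finset.smul_sum]
  refine Finset.sum_congr rfl fun i hi => ?_
  have := Finset.mem_range.1 hi
  rw [raiseThd_iterate, raiseSnd_iterate, smul_comm]
  simp only
  rw [show (p.1 : ℤ) + (p.2.1 + ((N - i : ℕ) : ℤ)) - j = p.1 + p.2.1 - j + N - i by lia]

/-- By Pascal's rule each difference lowers j by one. -/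
theorem shiftSub_pow_binomial (c : ℤ → V) (j : ℕ) :
    (shiftSub V raiseFst raiseSnd ^ (j + 1))
      (fun p => (p.1.choose j : ℂ) • c (p.1 + p.2.1 - j)) = 0 := by
  induction j with
  | zero =>
    funext p
    simp [shiftSub_apply, raiseFst, raiseSnd, add_right_comm, add_assoc]
  | succ j ih =>
    rw [pow_succ, Module.End.mul_apply]
    convert ih using 2
    funext p
    simp only [shiftSub_apply, raiseFst, raiseSnd]
    rw [Nat.choose_succ_succ, show ((p.1 + 1 : ℕ) : ℤ) + p.2.1 - ((j + 1 : ℕ) : ℤ) = p.1 + p.2.1 - j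
      by lia, show (p.1 : ℤ) + (p.2.1 + 1) - ((j + 1 : ℕ) : ℤ) = p.1 + p.2.1 - j by lia]
    push_cast
    module

theorem bracketDefect_large (A : VertexOperatorAlgebra V) {a b : V} {K : ℕ}
    (hK : ∀ n : ℤ, K ≤ n → A.mode a n b = 0) (v : V) :
    ∃ M : ℕ, ∀ (m : ℕ) (n : ℤ), A.bracketDefect a b K (m + M) n v = 0 := by
  obtain ⟨N₁, h₁⟩ := A.shiftSub_pow_bracket b v
  obtain ⟨N₂, h₂⟩ := A.shiftSub_pow_bracket_left a v
  choose N₃ h₃ using fun j : ℕ => A.shiftSub_pow_residue (A.mode a j b) v A.vac j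
  set M := N₁ + N₂ + ∑ j ∈ Finset.range K, N₃ j with hM
  refine ⟨M, fun m n => ?_⟩
  have hcomm : Commute (shiftSub V raiseFst raiseThd) (shiftSub V raiseSnd raiseThd) := by
    ext F p
    simp only [Module.End.mul_apply, shiftSub_apply, raiseFst, raiseSnd, raiseThd]
    abel
  have key := eq_zero_of_shiftSub_pow (M := M) (F := fun p : ℕ × ℤ × ℤ =>
    A.bracketDefect a b K p.1 p.2.1 (A.mode v p.2.2 A.vac)) ?_ ?_ m n
  · simpa [mode_neg_one_vac] using key
  · intro p hp
    simp only [A.mode_vac v hp, map_zero]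
  -- Subtract v_k applied to the defect on 𝟏, which is zero, and use a_m 𝟏 = 0: only commutators
  -- with v_k remain, each killed by one of the two powers. The identity operator `A.mode A.vac
  -- (-1)` merely fits the shape of `shiftSub_pow_bracket_left`.
  have hF : (fun p : ℕ × ℤ × ℤ => A.bracketDefect a b K p.1 p.2.1 (A.mode v p.2.2 A.vac)) =
      (fun p => A.mode a p.1 (A.mode b p.2.1 (A.mode v p.2.2 A.vac) -
        A.mode v p.2.2 (A.mode b p.2.1 A.vac))) +
      (fun p => A.mode A.vac (-1) (A.mode a p.1 (A.mode v p.2.2 (A.mode b p.2.1 A.vac)) -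
        A.mode v p.2.2 (A.mode a p.1 (A.mode b p.2.1 A.vac)))) -
      (fun p => A.mode b p.2.1 (A.mode a p.1 (A.mode v p.2.2 A.vac) -
        A.mode v p.2.2 (A.mode a p.1 A.vac))) -
      ∑ j ∈ Finset.range K, (fun p => (p.1.choose j : ℂ) •
        (A.mode (A.mode a j b) (p.1 + p.2.1 - j) (A.mode v p.2.2 A.vac) -
          A.mode v p.2.2 (A.mode (A.mode a j b) (p.1 + p.2.1 - j) A.vac))) := by
    funext p
    have h1 := congrArg (A.mode v p.2.2) (A.bracketDefect_vac hK p.1 p.2.1)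
    have ha : A.mode a p.1 A.vac = 0 := A.mode_vac a (by lia)
    rw [bracketDefect_apply] at h1
    simp only [map_sub, map_zero, map_sum, map_smul, ha, sub_zero, sub_eq_zero] at h1
    simp only [bracketDefect_apply, Pi.sub_apply, Pi.add_apply, Finset.sum_apply, smul_sub,
      Finset.sum_sub_distrib, map_sub, ha, map_zero, vac_mode, if_true, h1]
    abel
  have hQ := pow_apply_eq_zero_of_le (M := M) (h₁ (fun m => A.mode a m) A.vac) (by lia)
  have hP := pow_apply_eq_zero_of_le (M := M)
    (h₂ (fun _ => A.mode A.vac (-1)) fun n => A.mode b n A.vac) (by lia)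
  have hP' := pow_apply_eq_zero_of_le (M := M)
    (h₂ (fun n => A.mode b n) fun _ => A.vac) (by lia)
  rw [hF, add_sub_assoc, LinearMap.map_sub, LinearMap.map_add, hQ, zero_add, map_sum,
    Finset.sum_eq_zero, sub_zero, ← Module.End.mul_apply, (hcomm.pow_pow M M).eq,
    Module.End.mul_apply, LinearMap.map_sub, hP, hP', sub_zero, map_zero]
  intro j hj
  refine pow_apply_eq_zero_of_le (h₃ j) ?_
  have := Finset.single_le_sum (fun _ _ => Nat.zero_le _) hj (f := N₃)
  lia

/-- A power of the difference of the first two shifts kills the bracket by locality and the residue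
terms by `shiftSub_pow_binomial`; vanishing for large m then propagates downwards. -/
theorem bracketDefect_eq_zero (A : VertexOperatorAlgebra V) {a b : V} {K : ℕ}
    (hK : ∀ n : ℤ, K ≤ n → A.mode a n b = 0) (m : ℕ) (n : ℤ) (v : V) :
    A.bracketDefect a b K m n v = 0 := by
  obtain ⟨M, hM⟩ := A.bracketDefect_large hK v
  obtain ⟨N, hN⟩ := A.local_apply a b
  refine eq_zero_of_shiftSub_pow_of_large (N := N + K) (M := M) (k := 0)
    (F := fun p : ℕ × ℤ × ℤ => A.bracketDefect a b K p.1 p.2.1 v) ?_ hM m n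
  have h₁ : (shiftSub V raiseFst raiseSnd ^ N) (fun p : ℕ × ℤ × ℤ =>
      A.mode a p.1 (A.mode b p.2.1 v) - A.mode b p.2.1 (A.mode a p.1 v)) = 0 := by
    funext p
    rw [shiftSub_pow_apply (s := raiseFst) (t := raiseSnd) (fun _ => rfl), Pi.zero_apply,
      ← hN p.1 p.2.1 v]
    refine Finset.sum_congr rfl fun i hi => ?_
    have := Finset.mem_range.1 hi
    rw [raiseSnd_iterate, raiseFst_iterate]
    simp only
    rw [show ((p.1 + (N - i) : ℕ) : ℤ) = p.1 + N - i by lia]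
  have hF : (fun p : ℕ × ℤ × ℤ => A.bracketDefect a b K p.1 p.2.1 v) =
      (fun p => A.mode a p.1 (A.mode b p.2.1 v) - A.mode b p.2.1 (A.mode a p.1 v)) -
      ∑ j ∈ Finset.range K, (fun p => (p.1.choose j : ℂ) •
        (A.mode (A.mode a j b) (p.1 + p.2.1 - j) v)) := by
    funext p
    simp only [bracketDefect_apply, Pi.sub_apply, Finset.sum_apply]
  rw [hF, map_sub, map_sum, pow_apply_eq_zero_of_le h₁ (by lia), Finset.sum_eq_zero, sub_zero]
  intro j hj
  have := Finset.mem_range.1 hj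
  exact pow_apply_eq_zero_of_le
    (shiftSub_pow_binomial (fun n => A.mode (A.mode a j b) n v) j) (by lia)

/-- The commutator formula `[a_m, b_n] = ∑_j (m choose j) (a_j b)_{m+n-j}` for `m ≥ 0`. -/
theorem mode_commutator (A : VertexOperatorAlgebra V) (a b : V) (m : ℕ) (n : ℤ) (v : V) :
    A.mode a m (A.mode b n v) = A.mode b n (A.mode a m v) +
      ∑ j ∈ Finset.range (m + 1), (m.choose j : ℂ) • A.mode (A.mode a j b) (m + n - j) v := by
  obtain ⟨K, hK⟩ := A.exists_mode_eq_zero a b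
  -- The cutoff is enlarged beyond m so that the sum contains all j ≤ m; the binomial kills the
  -- rest.
  have h := A.bracketDefect_eq_zero (K := K + (m + 1)) (fun n hn => hK n (by lia)) m n v
  rw [bracketDefect_apply, sub_eq_zero, sub_eq_iff_eq_add'] at h
  rw [h, add_right_inj]
  refine (Finset.sum_subset (fun j hj => ?_) fun j _ hj => ?_).symm
  · have := Finset.mem_range.1 hj
    exact Finset.mem_range.2 (by lia)
  · rw [Nat.choose_eq_zero_of_lt (by simpa using hj), Nat.cast_zero, zero_smul]

end VertexOperatorAlgebra

/-! ### Weights, adjoints under the metric, and weight-one modes. -/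

namespace VertexOperatorAlgebra

variable {V : Type*} [AddCommGroup V] [Module ℂ V]

theorem weight_component (A : VertexOperatorAlgebra V) {v : V} {μ : ℂ}
    (h : A.mode A.conf 1 v = μ • v) :
    ∃ x : DirectSum ℕ fun k => A.grade k, DirectSum.coeLinearMap A.grade x = v ∧
      ∀ k : ℕ, (k : ℂ) ≠ μ → x k = 0 := by
  obtain ⟨x, rfl⟩ := A.isInternal_grade.2 v
  refine ⟨x, rfl, fun k hk => ?_⟩
  have hcomp : A.mode A.conf 1 ∘ₗ DirectSum.coeLinearMap A.grade =
      DirectSum.coeLinearMap A.grade ∘ₗ DirectSum.lmap fun k : ℕ =>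
        ((k : ℂ) • LinearMap.id : A.grade k →ₗ[ℂ] A.grade k) := by
    refine DirectSum.linearMap_ext _ fun k => LinearMap.ext fun y => ?_
    simpa [DirectSum.lmap_lof, mode] using A.weight k y y.2
  have hx : DirectSum.lmap (fun k : ℕ => ((k : ℂ) • LinearMap.id : A.grade k →ₗ[ℂ] A.grade k)) x =
      μ • x := by
    refine A.isInternal_grade.1 ?_
    change DirectSum.coeLinearMap A.grade _ = DirectSum.coeLinearMap A.grade _
    rw [map_smul]
    exact (LinearMap.congr_fun hcomp x).symm.trans h
  have hk' := DFunLike.congr_fun hx k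
  rw [DirectSum.lmap_apply, DirectSum.smul_apply, LinearMap.smul_apply, LinearMap.id_apply,
    ← sub_eq_zero, ← sub_smul] at hk'
  exact (smul_eq_zero.1 hk').resolve_left (sub_ne_zero.2 hk)

theorem eq_zero_of_weight (A : VertexOperatorAlgebra V) {v : V} {μ : ℂ}
    (h : A.mode A.conf 1 v = μ • v) (hμ : ∀ k : ℕ, (k : ℂ) ≠ μ) : v = 0 := by
  obtain ⟨x, rfl, hx⟩ := A.weight_component h
  rw [show x = 0 from DFinsupp.ext fun k => hx k (hμ k), map_zero]

theorem mem_grade_of_weight (A : VertexOperatorAlgebra V) {v : V} {k : ℕ}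
    (h : A.mode A.conf 1 v = (k : ℂ) • v) : v ∈ A.grade k := by
  obtain ⟨x, rfl, hx⟩ := A.weight_component h
  have : x = DirectSum.lof ℂ ℕ (fun k => A.grade k) k (x k) := by
    refine DFinsupp.ext fun j => ?_
    by_cases hj : j = k
    · subst hj; exact (DirectSum.lof_apply ℂ (M := fun k => A.grade k) j (x j)).symm
    · rw [hx j (by exact_mod_cast hj)]
      exact (DirectSum.of_eq_of_ne (β := fun k => A.grade k) k j (x k) hj).symm
  rw [this, DirectSum.coeLinearMap_lof]
  exact (x k).2

/-- This is [L_0, a_n] = (L_{-1}a)_{n+1} + (L_0 a)_n. -/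
theorem weight_mode (A : VertexOperatorAlgebra V) {a b : V} {k l : ℕ} (ha : a ∈ A.grade k)
    (hb : b ∈ A.grade l) (n : ℤ) :
    A.mode A.conf 1 (A.mode a n b) = ((k : ℂ) + l - n - 1) • A.mode a n b := by
  have h := A.mode_commutator A.conf a 1 n b
  have hw : A.mode A.conf 1 a = (k : ℂ) • a := A.weight k a ha
  have hw' : A.mode A.conf 1 b = (l : ℂ) • b := A.weight l b hb
  simp only [Finset.sum_range_succ, Finset.sum_range_zero, Nat.cast_one, Nat.cast_zero,
    Nat.choose_zero_right, Nat.choose_self, one_smul, zero_add, hw, hw', derivative_apply,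
    mode_smul_left, LinearMap.smul_apply, map_smul] at h
  rw [h, show (1 : ℤ) + n - 0 - 1 = n by ring, show (1 : ℤ) + n - 1 = n by ring]
  push_cast
  module

theorem mode_eq_zero_of_mem (A : VertexOperatorAlgebra V) {a b : V} {k l : ℕ} (ha : a ∈ A.grade k)
    (hb : b ∈ A.grade l) {n : ℤ} (hn : (k : ℤ) + l < n + 1) : A.mode a n b = 0 := by
  refine A.eq_zero_of_weight (A.weight_mode ha hb n) fun j hj => ?_
  have : (j : ℤ) = k + l - n - 1 := by exact_mod_cast hj
  lia

theorem mode_mem_grade (A : VertexOperatorAlgebra V) {a b : V} {k l r : ℕ} (ha : a ∈ A.grade k)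
    (hb : b ∈ A.grade l) {n : ℤ} (hn : (k : ℤ) + l = n + 1 + r) : A.mode a n b ∈ A.grade r := by
  refine A.mem_grade_of_weight ?_
  rw [A.weight_mode ha hb n]
  congr 1
  have : (k : ℂ) + l = n + 1 + r := by exact_mod_cast hn
  linear_combination this

theorem virasoro_apply (A : VertexOperatorAlgebra V) (m n : ℤ) (v : V) :
    A.L m (A.L n v) = A.L n (A.L m v) + ((m : ℂ) - n) • A.L (m + n) v +
      (if m + n = 0 then A.centralCharge / 12 * ((m : ℂ) ^ 3 - m) else 0) • v := by
  have h := LinearMap.congr_fun (A.virasoro m n) v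
  rw [LinearMap.sub_apply, sub_eq_iff_eq_add'] at h
  rw [add_assoc]
  exact h

theorem L_vac (A : VertexOperatorAlgebra V) {n : ℤ} (hn : -1 ≤ n) : A.L n A.vac = 0 :=
  A.mode_vac _ (by lia)

theorem L_neg_two_vac (A : VertexOperatorAlgebra V) : A.L (-2) A.vac = A.conf :=
  A.mode_neg_one_vac A.conf

theorem L_one_conf (A : VertexOperatorAlgebra V) : A.L 1 A.conf = 0 := by
  rw [← L_neg_two_vac, virasoro_apply, L_vac _ (by norm_num), map_zero,
    L_vac _ (by norm_num)]
  norm_num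

namespace IsLiZMetric

variable {A : VertexOperatorAlgebra V} {B : LinearMap.BilinForm ℂ V}

/-- Since L_1 ω = 0, only the term j = 0 of the invariance identity survives, with sign (-1)² = 1.
-/
theorem L_adjoint (hB : A.IsLiZMetric B) (n : ℤ) (a b : V) :
    B (A.L (-n) a) b = B a (A.L n b) := by
  have h := hB.invariant 2 A.conf A.conf_mem (n + 1) a b
  simp only [Finset.sum_range_succ, Finset.sum_range_zero, pow_succ, pow_zero, one_mul,
    Module.End.mul_apply, L_one_conf, map_zero, mode_zero_left, LinearMap.zero_apply] at h
  rw [L, L, ← h, show 2 * ((2 : ℕ) : ℤ) - (0 : ℕ) - (n + 1) - 2 = -n + 1 by push_cast; ring]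
  norm_num

theorem vac_L_one (hB : A.IsLiZMetric B) (c : V) : B A.vac (A.L 1 c) = 0 := by
  rw [← hB.L_adjoint, L_vac _ le_rfl, map_zero, LinearMap.zero_apply]

theorem eq_smul_vac (hB : A.IsLiZMetric B) {x : V} (hx : x ∈ A.grade 0) :
    x = B A.vac x • A.vac := by
  rw [A.grade_zero] at hx
  obtain ⟨t, rfl⟩ := Submodule.mem_span_singleton.1 hx
  rw [map_smul, hB.normalized, smul_eq_mul, mul_one]

/-- L_1 c is a multiple of 𝟏, and it is orthogonal to 𝟏 because L_{-1}𝟏 = 0. -/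
theorem L_one_of_mem_grade_one (hB : A.IsLiZMetric B) {c : V} (hc : c ∈ A.grade 1) :
    A.L 1 c = 0 := by
  rw [hB.eq_smul_vac (x := A.L 1 c) (A.mode_mem_grade A.conf_mem hc (by norm_num)),
    hB.vac_L_one, zero_smul]

theorem current_adjoint (hB : A.IsLiZMetric B) {c : V} (hc : c ∈ A.grade 1) (n : ℤ) (a b : V) :
    B (A.mode c (-n) a) b = - B a (A.mode c n b) := by
  have h := hB.invariant 1 c hc n a b
  simp only [Finset.sum_range_succ, Finset.sum_range_zero, pow_zero, pow_one,
    hB.L_one_of_mem_grade_one hc, map_zero, mode_zero_left, LinearMap.zero_apply] at h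
  rw [← h]
  norm_num

theorem current_one (hB : A.IsLiZMetric B) {a b : V} (ha : a ∈ A.grade 1) (hb : b ∈ A.grade 1) :
    A.mode a 1 b = -B a b • A.vac := by
  rw [hB.eq_smul_vac (x := A.mode a 1 b) (A.mode_mem_grade ha hb (by norm_num))]
  congr 1
  rw [← neg_eq_iff_eq_neg, ← hB.current_adjoint ha, mode_neg_one_vac]

/-- `[L_m, b_n] = -n b_{m+n}` for `b` of weight one and `m ≥ -1`. -/
theorem L_mode (hB : A.IsLiZMetric B) {b : V} (hb : b ∈ A.grade 1) (m : ℕ) (n : ℤ) (v : V) :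
    A.L (m + 1) (A.mode b n v) =
      A.mode b n (A.L (m + 1) v) - (n : ℂ) • A.mode b (m + 1 + n) v := by
  have h := A.mode_commutator A.conf b (m + 2) n v
  -- The mode ω_j b is L_{j-1}b: zero for j = 2 by the previous lemmas and for j > 2 by negative
  -- weight.
  have hz : ∀ j ∈ Finset.range (m + 3), j ∉ Finset.range 2 →
      ((m + 2).choose j : ℂ) • A.mode (A.mode A.conf j b) ((m + 2 : ℕ) + n - j) v = 0 := by
    intro j _ hj
    have hj' : 2 ≤ j := not_lt.1 fun h => hj (Finset.mem_range.2 h)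
    suffices A.mode A.conf j b = 0 by
      rw [this, mode_zero_left, LinearMap.zero_apply, smul_zero]
    rcases hj'.eq_or_lt with rfl | hj'
    · exact hB.L_one_of_mem_grade_one hb
    · exact A.mode_eq_zero_of_mem A.conf_mem hb (by push_cast; lia)
  rw [← Finset.sum_subset (Finset.range_mono (by lia)) hz] at h
  have hw : A.mode A.conf 1 b = b := by simpa [mode] using A.weight 1 b hb
  simp only [Finset.sum_range_succ, Finset.sum_range_zero, Nat.cast_one, Nat.cast_zero,
    Nat.choose_zero_right, Nat.choose_one_right, one_smul, zero_add, hw, derivative_apply,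
    LinearMap.smul_apply] at h
  rw [L, show ((m : ℤ) + 1 + 1) = ((m + 2 : ℕ) : ℤ) by push_cast; ring, h,
    show ((m + 2 : ℕ) : ℤ) + n - 0 - 1 = m + 1 + n by push_cast; ring,
    show ((m + 2 : ℕ) : ℤ) + n - 1 = m + 1 + n by push_cast; ring]
  push_cast
  module

theorem L_of_mem_grade_one (hB : A.IsLiZMetric B) {b : V} (hb : b ∈ A.grade 1) {n : ℤ}
    (hn : 1 ≤ n) : A.L n b = 0 := by
  rcases hn.eq_or_lt with rfl | hn
  · exact hB.L_one_of_mem_grade_one hb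
  · exact A.mode_eq_zero_of_mem A.conf_mem hb (by push_cast; lia)

theorem L_two_mode_neg_three (hB : A.IsLiZMetric B) {a b : V} (ha : a ∈ A.grade 1)
    (hb : b ∈ A.grade 1) : A.L 2 (A.mode a (-3) b) = (3 : ℂ) • A.mode a (-1) b := by
  have h := hB.L_mode ha 1 (-3) b
  norm_num [hB.L_of_mem_grade_one hb] at h
  exact h

theorem L_two_mode_neg_one (hB : A.IsLiZMetric B) {a b : V} (ha : a ∈ A.grade 1)
    (hb : b ∈ A.grade 1) : A.L 2 (A.mode a (-1) b) = -B a b • A.vac := by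
  have h := hB.L_mode ha 1 (-1) b
  norm_num [hB.L_of_mem_grade_one hb] at h
  rw [h, hB.current_one ha hb]

theorem L_four_mode_neg_three (hB : A.IsLiZMetric B) {a b : V} (ha : a ∈ A.grade 1)
    (hb : b ∈ A.grade 1) : A.L 4 (A.mode a (-3) b) = (-3 * B a b) • A.vac := by
  have h := hB.L_mode ha 3 (-3) b
  norm_num [hB.L_of_mem_grade_one hb] at h
  rw [h, hB.current_one ha hb, smul_smul]
  congr 1; ring

/-- Only u_0 b and u_1 b = -⟨u,b⟩𝟏 contribute, the latter with coefficient (3 choose 1); u_3 c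
vanishes by weight. -/
theorem mode_three_mode_neg_three (hB : A.IsLiZMetric B) {u b c : V} (hu : u ∈ A.grade 1)
    (hb : b ∈ A.grade 1) (hc : c ∈ A.grade 1) :
    A.mode u 3 (A.mode b (-3) c) =
      A.mode (A.mode u 0 b) 0 c - (3 * B u b) • c := by
  have h := A.mode_commutator u b 3 (-3) c
  have h2 : A.mode u 2 b = 0 := A.mode_eq_zero_of_mem hu hb (by norm_num)
  have h3 : A.mode u 3 b = 0 := A.mode_eq_zero_of_mem hu hb (by norm_num)
  have h3' : A.mode u 3 c = 0 := A.mode_eq_zero_of_mem hu hc (by norm_num)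
  norm_num [Finset.sum_range_succ, h2, h3, h3', hB.current_one hu hb, mode_zero_left,
    ← neg_smul, mode_smul_left, vac_mode, -neg_smul] at h
  rw [h, smul_smul]
  module

/-- Unlike u_3 c, the vector u_1 c need not vanish; it supplies the extra multiple of b. -/
theorem mode_one_mode_neg_one (hB : A.IsLiZMetric B) {u b c : V} (hu : u ∈ A.grade 1)
    (hb : b ∈ A.grade 1) (hc : c ∈ A.grade 1) :
    A.mode u 1 (A.mode b (-1) c) =
      A.mode (A.mode u 0 b) 0 c - B u b • c - B u c • b := by
  have h := A.mode_commutator u b 1 (-1) c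
  norm_num [Finset.sum_range_succ, hB.current_one hu hb, hB.current_one hu hc,
    mode_smul_left, vac_mode, mode_neg_one_vac, ← neg_smul, -neg_smul] at h
  rw [h]
  module

end IsLiZMetric

end VertexOperatorAlgebra

/-! ### Weight-four descendants of the vacuum. -/

namespace VertexOperatorAlgebra

variable {V : Type*} [AddCommGroup V] [Module ℂ V]

theorem L_neg_one_L_neg_two_vac (A : VertexOperatorAlgebra V) :
    A.L (-1) (A.L (-2) A.vac) = A.L (-3) A.vac := by
  rw [virasoro_apply, L_vac _ le_rfl]
  norm_num

theorem L_neg_one_L_neg_three_vac (A : VertexOperatorAlgebra V) :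
    A.L (-1) (A.L (-3) A.vac) = (2 : ℂ) • A.L (-4) A.vac := by
  rw [virasoro_apply, L_vac _ le_rfl]
  norm_num

theorem exists_of_mem_vacuumDescendants_four (A : VertexOperatorAlgebra V) {x : V}
    (hx : x ∈ A.vacuumDescendants 4) :
    ∃ p q : ℂ, x = p • A.L (-4) A.vac + q • A.L (-2) (A.L (-2) A.vac) := by
  suffices h : A.vacuumDescendants 4 ≤
      Submodule.span ℂ {A.L (-4) A.vac, A.L (-2) (A.L (-2) A.vac)} by
    obtain ⟨p, q, h⟩ := Submodule.mem_span_pair.1 (h hx)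
    exact ⟨p, q, h.symm⟩
  refine Submodule.span_le.2 ?_
  have h1 : A.L (-1) A.vac = 0 := A.L_vac le_rfl
  have h4 : A.L (-4) A.vac ∈ Submodule.span ℂ {A.L (-4) A.vac, A.L (-2) (A.L (-2) A.vac)} :=
    Submodule.subset_span (by simp)
  have h22 : A.L (-2) (A.L (-2) A.vac) ∈
      Submodule.span ℂ {A.L (-4) A.vac, A.L (-2) (A.L (-2) A.vac)} :=
    Submodule.subset_span (by simp)
  have h13 : A.L (-1) (A.L (-3) A.vac) ∈
      Submodule.span ℂ {A.L (-4) A.vac, A.L (-2) (A.L (-2) A.vac)} := by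
    rw [L_neg_one_L_neg_three_vac]
    exact Submodule.smul_mem _ _ h4
  rintro v ⟨l, hl, hsum, rfl⟩
  -- Run over the compositions of 4: those ending in 1 give zero, while 1+3 and 1+1+2 reduce to
  -- L_{-4}𝟏.
  rcases l with _ | ⟨a, _ | ⟨b, _ | ⟨c, _ | ⟨d, _ | ⟨e, l⟩⟩⟩⟩⟩ <;>
    simp only [List.mem_cons, List.not_mem_nil, or_false, forall_eq_or_imp, forall_eq,
      List.sum_cons, List.sum_nil] at hl hsum
  · simp at hsum
  · obtain rfl : a = 4 := by lia
    simpa using h4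
  · have : a ≤ 3 := by lia
    interval_cases a
    · lia
    · obtain rfl : b = 3 := by lia
      simpa using h13
    · obtain rfl : b = 2 := by lia
      simpa using h22
    · obtain rfl : b = 1 := by lia
      simp [h1]
  · have : a ≤ 2 := by lia
    have : b ≤ 2 := by lia
    interval_cases a <;> interval_cases b <;> try lia
    · obtain rfl : c = 2 := by lia
      simpa [L_neg_one_L_neg_two_vac] using h13
    · obtain rfl : c = 1 := by lia
      simp [h1]
    · obtain rfl : c = 1 := by lia
      simp [h1]
  · obtain rfl : d = 1 := by lia
    simp [h1]
  · lia

theorem L_two_L_neg_two_vac (A : VertexOperatorAlgebra V) :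
    A.L 2 (A.L (-2) A.vac) = (A.centralCharge / 2) • A.vac := by
  rw [virasoro_apply, L_vac _ (by norm_num), map_zero, zero_add,
    show (2 : ℤ) + -2 = 0 by norm_num, L_vac _ (by norm_num), smul_zero, zero_add]
  norm_num
  congr 1; ring

theorem L_four_L_neg_four_vac (A : VertexOperatorAlgebra V) :
    A.L 4 (A.L (-4) A.vac) = (5 * A.centralCharge) • A.vac := by
  rw [virasoro_apply, L_vac _ (by norm_num), map_zero, zero_add,
    show (4 : ℤ) + -4 = 0 by norm_num, L_vac _ (by norm_num), smul_zero, zero_add]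
  norm_num
  congr 1; ring

theorem L_four_L_neg_two_vac (A : VertexOperatorAlgebra V) : A.L 4 (A.L (-2) A.vac) = 0 := by
  rw [virasoro_apply, L_vac _ (by norm_num), map_zero, zero_add,
    show (4 : ℤ) + -2 = 2 by norm_num, L_vac _ (by norm_num), smul_zero, zero_add]
  norm_num

theorem L_zero_L_neg_two_vac (A : VertexOperatorAlgebra V) :
    A.L 0 (A.L (-2) A.vac) = (2 : ℂ) • A.L (-2) A.vac := by
  rw [virasoro_apply, L_vac _ (by norm_num), map_zero, zero_add]
  norm_num

theorem L_two_L_neg_four_vac (A : VertexOperatorAlgebra V) :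
    A.L 2 (A.L (-4) A.vac) = (6 : ℂ) • A.L (-2) A.vac := by
  rw [virasoro_apply, L_vac _ (by norm_num), map_zero, zero_add]
  norm_num

theorem L_four_descendant (A : VertexOperatorAlgebra V) (p q : ℂ) :
    A.L 4 (p • A.L (-4) A.vac + q • A.L (-2) (A.L (-2) A.vac)) =
      (5 * A.centralCharge * p + 3 * A.centralCharge * q) • A.vac := by
  have h22 : A.L 4 (A.L (-2) (A.L (-2) A.vac)) = (3 * A.centralCharge) • A.vac := by
    rw [virasoro_apply, L_four_L_neg_two_vac, map_zero, zero_add,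
      show (4 : ℤ) + -2 = 2 by norm_num, L_two_L_neg_two_vac, smul_smul]
    norm_num
    congr 1; ring
  rw [map_add, map_smul, map_smul, L_four_L_neg_four_vac, h22]
  module

theorem L_two_descendant (A : VertexOperatorAlgebra V) (p q : ℂ) :
    A.L 2 (p • A.L (-4) A.vac + q • A.L (-2) (A.L (-2) A.vac)) =
      (6 * p + (8 + A.centralCharge) * q) • A.L (-2) A.vac := by
  have h22 : A.L 2 (A.L (-2) (A.L (-2) A.vac)) = (8 + A.centralCharge) • A.L (-2) A.vac := by
    rw [virasoro_apply, L_two_L_neg_two_vac, map_smul, show (2 : ℤ) + -2 = 0 by norm_num,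
      L_zero_L_neg_two_vac, smul_smul, if_pos rfl, ← add_smul, ← add_smul]
    norm_num
    congr 1; ring
  rw [map_add, map_smul, map_smul, L_two_L_neg_four_vac, h22]
  module

end VertexOperatorAlgebra

/-! ### The four equations and their elimination. -/

theorem mainTheorem9 {V : Type*} [AddCommGroup V] [Module ℂ V]
    (A : VertexOperatorAlgebra V)
    (B : LinearMap.BilinForm ℂ V) (hB : A.IsLiZMetric B)
    (hd : 0 < Module.finrank ℂ (A.grade 1))
    {ι : Type*} [Fintype ι] [DecidableEq ι]
    (uLow uUp : Module.Basis ι ℂ (A.grade 1))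
    (hdual : ∀ α β : ι, B (uUp α : V) (uLow β : V) = if α = β then 1 else 0)
    (hcas : A.casimir (fun α => (uLow α : V)) (fun α => (uUp α : V)) 4 ∈ A.vacuumDescendants 4)
    (hC0 : A.centralCharge ≠ 0) (hC1 : A.centralCharge ≠ -22 / 5) :
    A.centralCharge ≠ 10 ∧
      (Module.finrank ℂ (A.grade 1) : ℂ) =
        A.centralCharge * (5 * A.centralCharge + 22) / (10 - A.centralCharge) := by
  have hL := fun α => (uLow α).2
  have hU := fun α => (uUp α).2
  have hcard : Module.finrank ℂ (A.grade 1) = Fintype.card ι := Module.finrank_eq_card_basis uLow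
  obtain ⟨α₀⟩ : Nonempty ι := Fintype.card_pos_iff.1 (hcard ▸ hd)
  have hvac : A.vac ≠ 0 := A.vac_ne_zero
  obtain ⟨p, q, hpq⟩ := A.exists_of_mem_vacuumDescendants_four hcas
  have hlam : A.casimir (fun α => (uLow α : V)) (fun α => (uUp α : V)) 4 =
      ∑ α, A.mode (uUp α : V) (-3) (uLow α : V) := by norm_num [VertexOperatorAlgebra.casimir]
  rw [hlam] at hpq
  set C := A.centralCharge with hC
  set b : V := (uLow α₀ : V) with hb
  set c : V := (uUp α₀ : V) with hc
  have hbm : b ∈ A.grade 1 := hL α₀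
  have hcm : c ∈ A.grade 1 := hU α₀
  have hbc : B b c = 1 := by rw [hB.symm, hdual, if_pos rfl]
  have hUb : ∀ α, B (uUp α) b = if α = α₀ then 1 else 0 := fun α => hdual α α₀
  have hLc : ∀ α, B (uLow α) c = if α = α₀ then 1 else 0 := fun α => by
    rw [hB.symm, hdual]; simp [eq_comm]
  have hexp : ∀ x ∈ A.grade 1, ∑ α, B (uUp α) x • (uLow α : V) = x := by
    intro x hx
    have h1 : ∑ α, uLow.repr ⟨x, hx⟩ α • (uLow α : V) = x := by
      simpa only [map_sum, map_smul, Submodule.subtype_apply] using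
        congrArg (A.grade 1).subtype (uLow.sum_repr ⟨x, hx⟩)
    have h2 : ∀ α, B (uUp α) x = uLow.repr ⟨x, hx⟩ α := by
      intro α
      conv_lhs => rw [← h1]
      simp [map_sum, hdual]
    simp_rw [h2]
    exact h1
  have hsum : ∑ α, B (uUp α) c * B (uLow α) b = 1 := by
    have := congrArg (fun y => B y b) (hexp c hcm)
    simpa [LinearMap.sum_apply, hB.symm c b, hbc] using this
  have e4 : -3 * (Fintype.card ι : ℂ) = 5 * C * p + 3 * C * q := by
    have h := congrArg (A.L 4) hpq
    rw [A.L_four_descendant, map_sum] at h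
    simp_rw [fun α => hB.L_four_mode_neg_three (hU α) (hL α), hdual] at h
    rw [← Finset.sum_smul] at h
    have := smul_left_injective ℂ hvac h
    simp at this
    rw [← this]; ring
  have h2 : (3 : ℂ) • ∑ α, A.mode (uUp α : V) (-1) (uLow α : V) =
      (6 * p + (8 + C) * q) • A.L (-2) A.vac := by
    have h := congrArg (A.L 2) hpq
    rw [A.L_two_descendant, map_sum] at h
    rw [← h, Finset.smul_sum]
    exact Finset.sum_congr rfl fun α _ => (hB.L_two_mode_neg_three (hU α) (hL α)).symm
  have e2 : -3 * (Fintype.card ι : ℂ) = (6 * p + (8 + C) * q) * (C / 2) := by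
    have h := congrArg (A.L 2) h2
    rw [map_smul, map_smul, A.L_two_L_neg_two_vac, map_sum] at h
    simp_rw [fun α => hB.L_two_mode_neg_one (hU α) (hL α), hdual] at h
    rw [← Finset.sum_smul, smul_smul, smul_smul] at h
    have := smul_left_injective ℂ hvac h
    simp at this
    rw [← this]; ring
  set X : ℂ := ∑ α, B (uLow α) (A.mode (A.mode (uUp α : V) 0 b) 0 c) with hX
  -- On the left the modes u^α_{-3} pass to the other side as -u^α_3; on the right L_{-4} and
  -- L_{-2}² pass over as L_4 and L_2².
  have f4 : -X + 3 = -3 * (p + q) := by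
    have h := congrArg (fun y => B y (A.mode b (-3) c)) hpq
    simp only [map_add, map_smul, LinearMap.add_apply, LinearMap.smul_apply, hB.L_adjoint,
      hB.L_four_mode_neg_three hbm hcm, hB.L_two_mode_neg_three hbm hcm,
      hB.L_two_mode_neg_one hbm hcm, hbc, hB.normalized, map_sum, LinearMap.sum_apply,
      fun α => hB.current_adjoint (hU α), fun α => hB.mode_three_mode_neg_three (hU α) hbm hcm,
      map_sub, smul_eq_mul, neg_sub, Finset.sum_sub_distrib] at h
    simp [hUb, hLc, ← hX] at h
    linear_combination h
  -- The 2 is one from ⟨u^α,b⟩⟨u_α,c⟩ and one from `hsum`.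
  have f2 : 3 * (-X + 2) = -(6 * p + (8 + C) * q) := by
    have h := congrArg (fun y => B y (A.mode b (-1) c)) h2
    simp only [map_smul, LinearMap.smul_apply, hB.L_adjoint,
      hB.L_two_mode_neg_one hbm hcm, hbc, hB.normalized, map_sum, LinearMap.sum_apply,
      fun α => hB.current_adjoint (hU α), fun α => hB.mode_one_mode_neg_one (hU α) hbm hcm,
      map_sub, map_smul, smul_eq_mul, neg_sub, Finset.sum_sub_distrib, hsum] at h
    simp [hUb, hLc, ← hX] at h
    linear_combination h
  have hp : p = (C + 2) / 4 * q := by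
    refine mul_left_cancel₀ hC0 ?_
    linear_combination (e2 - e4) / 2
  -- In this combination X cancels, and 24 - 36 leaves the constant -12.
  have hq : q * (C - 10) = 12 := by
    rw [hp] at f2 f4
    linear_combination 4 * f2 - 12 * f4
  have h10 : C ≠ 10 := by
    rintro h
    rw [h] at hq
    norm_num at hq
  refine ⟨h10, ?_⟩
  rw [hcard, eq_div_iff (sub_ne_zero.2 h10.symm)]
  rw [hp] at e4
  linear_combination (C - 10) / 3 * e4 + C * (5 * C + 22) / 12 * hq
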